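/- Let $G$ be an arbitrary group, let $\mathbb{Z}G$ be its integral group ring with augmentation map $\varepsilon:\mathbb{Z}G\to\mathbb{Z}$, $\varepsilon(\sum_g n_g g)=\sum_g n_g$, and let $\Delta(G)=\ker\varepsilon$ be the augmentation ideal. Let $\mathcal{V}(\mathbb{Z}G)$ be the group of units of $\mathbb{Z}G$ of augmentation $1$, put $\mathcal{V}_n(\mathbb{Z}G)=\mathcal{V}(\mathbb{Z}G)\cap(1+\Delta(G)^n)$ for $n\ge 1$, and let $\mathcal{V}_\omega(\mathbb{Z}G)=\bigcap_{n\ge 1}\mathcal{V}_n(\mathbb{Z}G)$ be the $\Delta$-adic residue of $\mathcal{V}(\mathbb{Z}G)$. If $\mathcal{V}_\omega(\mathbb{Z}G)=\{1\}$, then $G$ has no element of order $pq$ with primes $p<q$, except possibly when $(p,q)=(2,3)$. In particular, if moreover $G$ has no element of order $2$ or $G$ has no element of order $3$, then every torsion element of $G$ has prime-power order (that is, order $p^k$ with $p$ a prime and $k\ge 0$). -/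

import Mathlib

namespace IntegralGroupRing

variable (G : Type*) [Group G]

/-- The augmentation map `ℤG → ℤ`, `∑ n_g g ↦ ∑ n_g`. -/
noncomputable def augmentation : MonoidAlgebra ℤ G →ₐ[ℤ] ℤ :=
  MonoidAlgebra.lift ℤ ℤ G (1 : G →* ℤ)

/-- The augmentation ideal `Δ(G)` of `ℤG`, the kernel of the augmentation map. -/
noncomputable def augmentationIdeal : Ideal (MonoidAlgebra ℤ G) :=
  RingHom.ker (augmentation G)

/-- The group `𝒱(ℤG)` of normalized units: the units of augmentation one in `ℤG`. -/
noncomputable def normalizedUnits : Subgroup (MonoidAlgebra ℤ G)ˣ where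
  carrier := {u | augmentation G (u : MonoidAlgebra ℤ G) = 1}
  one_mem' := by simp
  mul_mem' := by
    intro u v hu hv
    simp only [Set.mem_ofPred_eq] at hu hv ⊢
    rw [Units.val_mul, map_mul, hu, hv, one_mul]
  inv_mem' := by
    intro u hu
    simp only [Set.mem_ofPred_eq] at hu ⊢
    have h := congrArg (augmentation G) u.mul_inv
    rwa [map_mul, hu, one_mul, map_one] at h

/-- `𝒱_n(ℤG) = 𝒱(ℤG) ∩ (1 + Δ^n(G))`. -/
noncomputable def normalizedUnitsFiltration (n : ℕ) : Subgroup (MonoidAlgebra ℤ G)ˣ where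
  carrier := {u | u ∈ normalizedUnits G ∧
    (u : MonoidAlgebra ℤ G) - 1 ∈ augmentationIdeal G ^ n}
  one_mem' := ⟨one_mem _, by simp⟩
  mul_mem' := by
    rintro u v ⟨hu, hu'⟩ ⟨hv, hv'⟩
    refine ⟨mul_mem hu hv, ?_⟩
    have h : ((u * v : (MonoidAlgebra ℤ G)ˣ) : MonoidAlgebra ℤ G) - 1
        = (u : MonoidAlgebra ℤ G) * ((v : MonoidAlgebra ℤ G) - 1) + (u - 1) := by
      rw [Units.val_mul, mul_sub, mul_one, sub_add_sub_cancel]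
    rw [h]
    exact add_mem (Ideal.mul_mem_left _ _ hv') hu'
  inv_mem' := by
    rintro u ⟨hu, hu'⟩
    refine ⟨inv_mem hu, ?_⟩
    have h : ((u⁻¹ : (MonoidAlgebra ℤ G)ˣ) : MonoidAlgebra ℤ G) - 1
        = -(((u⁻¹ : (MonoidAlgebra ℤ G)ˣ) : MonoidAlgebra ℤ G)
            * ((u : MonoidAlgebra ℤ G) - 1)) := by
      rw [mul_sub, mul_one, Units.inv_mul, neg_sub]
    rw [h]
    exact neg_mem (Ideal.mul_mem_left _ _ hu')

/-- The `Δ`-adic residue `𝒱_ω(ℤG) = ⋂_{n ≥ 1} 𝒱_n(ℤG)` of `𝒱(ℤG)`. -/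
noncomputable def deltaAdicResidue : Subgroup (MonoidAlgebra ℤ G)ˣ :=
  ⨅ n : ℕ, ⨅ _ : 1 ≤ n, normalizedUnitsFiltration G n

end IntegralGroupRing

open Polynomial

namespace IntegralGroupRing

/-! Let `g` have order `n > 6`, not a prime power, and let `f = (X ^ n - 1) / Φ_n`. As `Φ_n(1) = 1`,
`X - 1` is a unit modulo `Φ_n`; since `f * Φ_n` vanishes at `g`, `f(g)` is fixed by a multiple of `g
- 1`, hence lies in every `Δ ^ k`. Some `(X - 1) ^ m` is `1` modulo `(n, Φ_n)`, and `n ∈ (f, Φ_n)`,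
so it agrees modulo `Φ_n` with some `1 + w * f`, which gives a unit of the residue
(`exists_unit_one_add_mul`). It is nontrivial because `|ζ - 1| < 1` for `ζ = exp(2πi/n)`. -/

/-- If `n` is not a prime power, then `X - 1` is invertible modulo the `n`-th cyclotomic
polynomial. -/
theorem exists_mul_X_sub_one_add_cyclotomic_eq_one {n : ℕ}
    (hn : ∀ {p : ℕ}, p.Prime → ∀ k : ℕ, p ^ k ≠ n) :
    ∃ v : ℤ[X], v * (X - 1) + cyclotomic n ℤ = 1 := by
  have h : (X - C 1 : ℤ[X]) ∣ 1 - cyclotomic n ℤ := by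
    rw [dvd_iff_isRoot, IsRoot, eval_sub, eval_one, eval_one_cyclotomic_not_prime_pow hn, sub_self]
  obtain ⟨v, hv⟩ := h
  refine ⟨v, ?_⟩
  rw [C_1] at hv
  linear_combination -hv

/-- Modulo `n` and the `n`-th cyclotomic polynomial, some positive power of `X - 1` is `1`. -/
theorem exists_X_sub_one_pow_eq_one_add {n : ℕ} (hn0 : n ≠ 0)
    (hn : ∀ {p : ℕ}, p.Prime → ∀ k : ℕ, p ^ k ≠ n) :
    ∃ m : ℕ, 0 < m ∧ ∃ a b : ℤ[X], (X - 1) ^ m = 1 + (n : ℤ[X]) * a + cyclotomic n ℤ * b := by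
  obtain ⟨v, hv⟩ := exists_mul_X_sub_one_add_cyclotomic_eq_one hn
  have : NeZero n := ⟨hn0⟩
  -- The target is a finite ring, so the unit `φ (X - 1)` has finite order.
  let φ : ℤ[X] →+* AdjoinRoot (cyclotomic n (ZMod n)) :=
    (AdjoinRoot.mk _).comp (mapRingHom (Int.castRingHom (ZMod n)))
  have hφ : φ (cyclotomic n ℤ) = 0 := by
    simp [φ, map_cyclotomic]
  have : Module.Finite (ZMod n) (AdjoinRoot (cyclotomic n (ZMod n))) :=
    (cyclotomic.monic n (ZMod n)).finite_adjoinRoot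
  have : Finite (AdjoinRoot (cyclotomic n (ZMod n))) := Module.finite_of_finite (ZMod n)
  have hu : φ v * φ (X - 1) = 1 := by
    have := congrArg φ hv
    rwa [map_add, hφ, add_zero, map_mul, map_one] at this
  let u : (AdjoinRoot (cyclotomic n (ZMod n)))ˣ := Units.mkOfMulEqOne _ _ ((mul_comm _ _).trans hu)
  obtain ⟨m, hm, hum⟩ := (isOfFinOrder_of_finite u).exists_pow_eq_one
  refine ⟨m, hm, ?_⟩
  have h1 : φ ((X - 1) ^ m - 1) = 0 := by
    have h2 : φ (X - 1) ^ m = 1 := by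
      have := congrArg Units.val hum
      simpa [u] using this
    rw [map_sub, map_pow, h2, map_one, sub_self]
  obtain ⟨b, hb⟩ := AdjoinRoot.mk_eq_zero.1 h1
  obtain ⟨b, rfl⟩ := map_surjective (Int.castRingHom (ZMod n)) (ZMod.ringHom_surjective _) b
  have h3 : C (n : ℤ) ∣ (X - 1) ^ m - 1 - cyclotomic n ℤ * b := by
    rw [C_dvd_iff_dvd_coeff]
    intro i
    rw [← ZMod.intCast_zmod_eq_zero_iff_dvd, ← eq_intCast (Int.castRingHom (ZMod n)), ← coeff_map,
      Polynomial.map_sub, Polynomial.map_mul, map_cyclotomic, ← hb, coe_mapRingHom, sub_self,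
      coeff_zero]
  obtain ⟨a, ha⟩ := h3
  refine ⟨a, b, ?_⟩
  have : (C (n : ℤ) : ℤ[X]) = (n : ℤ[X]) := by simp
  rw [this] at ha
  linear_combination ha

/-- If `f * cyclotomic n = X ^ n - 1`, then `f` divides `n` modulo the cyclotomic polynomial. -/
theorem exists_natCast_eq_mul_add_cyclotomic_mul {n : ℕ} (hn0 : n ≠ 0) {f : ℤ[X]}
    (hf : f * cyclotomic n ℤ = X ^ n - 1) :
    ∃ r s : ℤ[X], (n : ℤ[X]) = f * r + cyclotomic n ℤ * s := by
  -- Differentiating and multiplying by `X` puts `n * X ^ n` in the ideal `(f, Φ_n)`, and `X ^ n = 1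
  -- + f * Φ_n`.
  have h := congrArg derivative hf
  rw [derivative_mul, derivative_sub, derivative_X_pow, derivative_one, sub_zero] at h
  have h2 : (X : ℤ[X]) ^ (n - 1) * X = X ^ n := pow_sub_one_mul hn0 X
  refine ⟨derivative (cyclotomic n ℤ) * X,
    derivative f * X - (n : ℤ[X]) * f, ?_⟩
  have h4 := congrArg (· * X) h
  simp only [map_natCast] at h4
  linear_combination -h4 + (n : ℤ[X]) * hf - (n : ℤ[X]) * h2

/-- The chord is at most the arc `2π/n`, which is below `1` from `n = 7` on. At `n = 6` the chord
has length exactly `1`; this is why `(2, 3)` is excluded. -/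
theorem norm_exp_two_pi_mul_I_div_sub_one_lt_one {n : ℕ} (hn : 6 < n) :
    ‖Complex.exp (2 * Real.pi * Complex.I / n) - 1‖ < 1 := by
  have h : (2 * Real.pi * Complex.I / n : ℂ) = Complex.I * ((2 * Real.pi / n : ℝ) : ℂ) := by
    push_cast; ring
  rw [h]
  refine (Real.norm_exp_I_mul_ofReal_sub_one_le).trans_lt ?_
  have hn' : (7 : ℝ) ≤ n := by exact_mod_cast hn
  rw [Real.norm_of_nonneg (by positivity), div_lt_one (by linarith)]
  linarith [Real.pi_lt_d2]

/-- For `n > 6` not a prime power and `f = (X ^ n - 1) / Φ_n`, there is a nontrivial unit of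
`ℤ[X] / (X ^ n - 1)` congruent to `1` modulo `f`. -/
theorem exists_unit_one_add_mul {n : ℕ} (hn6 : 6 < n)
    (hn : ∀ {p : ℕ}, p.Prime → ∀ k : ℕ, p ^ k ≠ n) {f : ℤ[X]}
    (hf : f * cyclotomic n ℤ = X ^ n - 1) :
    ∃ w w' : ℤ[X], (X ^ n - 1) ∣ (1 + w * f) * (1 + w' * f) - 1 ∧ ¬ (X ^ n - 1) ∣ w * f := by
  have hn0 : n ≠ 0 := by omega
  obtain ⟨v, hv⟩ := exists_mul_X_sub_one_add_cyclotomic_eq_one hn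
  obtain ⟨m, hm, a, b, hab⟩ := exists_X_sub_one_pow_eq_one_add hn0 hn
  obtain ⟨r, s, hrs⟩ := exists_natCast_eq_mul_add_cyclotomic_mul hn0 hf
  have hw : (X - 1 : ℤ[X]) ^ m = 1 + r * a * f + cyclotomic n ℤ * (s * a + b) := by
    rw [hab, hrs]; ring
  -- Modulo `f` both factors are `1`; modulo `Φ_n` they are `(X - 1) ^ m` and its inverse `v ^ m`.
  refine ⟨r * a, -(r * a) * v ^ m, ?_, ?_⟩
  · have h1 : cyclotomic n ℤ ∣ 1 - v ^ m * (X - 1) ^ m := by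
      rw [← mul_pow]
      have := sub_dvd_pow_sub_pow 1 (v * (X - 1)) m
      rw [one_pow] at this
      refine dvd_trans (dvd_of_eq ?_) this
      linear_combination hv
    obtain ⟨c, hc⟩ := h1
    refine ⟨r * a * (c + v ^ m * (s * a + b)), ?_⟩
    rw [← hf]
    rw [hw] at hc
    linear_combination r * a * f * hc
  · rintro ⟨c, hc⟩
    -- If `X ^ n - 1` divided `w * f`, evaluating `hw` at `ζ` would give `(ζ - 1) ^ m = 1`.
    set ζ : ℂ := Complex.exp (2 * Real.pi * Complex.I / n)
    have hζ : IsPrimitiveRoot ζ n := Complex.isPrimitiveRoot_exp n hn0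
    have h0 : aeval ζ (cyclotomic n ℤ) = 0 := by
      have := hζ.isRoot_cyclotomic (Nat.pos_of_ne_zero hn0)
      rwa [IsRoot, ← map_cyclotomic_int, eval_map] at this
    have h1 := congrArg (aeval ζ) hw
    rw [hc] at h1
    simp only [map_pow, map_sub, map_add, map_mul, aeval_X, map_one, h0, hζ.pow_eq_one, sub_self,
      zero_mul, add_zero] at h1
    have h2 := congrArg norm h1
    rw [norm_pow, norm_one] at h2
    exact (pow_lt_one₀ (norm_nonneg _) (norm_exp_two_pi_mul_I_div_sub_one_lt_one hn6) hm.ne').ne h2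

/-- The kernel of `ℤ[X] → ℤG`, `X ↦ g`, is generated by `X ^ n - 1` with `n` the order of `g`. -/
theorem X_pow_orderOf_sub_one_dvd_of_aeval_of_eq_zero {G : Type*} [Group G] {g : G}
    (hg : IsOfFinOrder g) {P : ℤ[X]} (hP : aeval (MonoidAlgebra.of ℤ G g) P = 0) :
    (X ^ orderOf g - 1) ∣ P := by
  have hpos : 0 < orderOf g := hg.orderOf_pos
  have hmon : (X ^ orderOf g - 1 : ℤ[X]).Monic := monic_X_pow_sub_C 1 hpos.ne'
  rw [← modByMonic_eq_zero_iff_dvd hmon]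
  -- `R` has degree below the order of `g`, so its coefficients are those of `R(g)` at the distinct
  -- elements `g ^ i`.
  set R := P %ₘ (X ^ orderOf g - 1)
  have hR : aeval (MonoidAlgebra.of ℤ G g) R = 0 := by
    have h := congrArg (aeval (MonoidAlgebra.of ℤ G g)) (modByMonic_add_div P (X ^ orderOf g - 1))
    rw [map_add, map_mul, map_sub, map_pow, aeval_X, ← map_pow, pow_orderOf_eq_one, map_one,
      map_one, sub_self, zero_mul, add_zero, hP] at h
    exact h
  have hdeg : R.natDegree < orderOf g := by
    have h1 : (X ^ orderOf g - 1 : ℤ[X]).natDegree = orderOf g := natDegree_X_pow_sub_C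
    have := natDegree_modByMonic_lt P hmon (fun h => by
      rw [h, natDegree_one] at h1; omega)
    rwa [h1] at this
  ext i
  rw [coeff_zero]
  by_cases hi : i < orderOf g
  · rw [aeval_eq_sum_range' hdeg] at hR
    have h := congrArg (fun x : MonoidAlgebra ℤ G => x.coeff (g ^ i)) hR
    simp only [MonoidAlgebra.coeff_sum, Finsupp.finsetSum_apply, MonoidAlgebra.coeff_smul,
      Finsupp.smul_apply, MonoidAlgebra.of_apply, MonoidAlgebra.single_pow, one_pow,
      MonoidAlgebra.coeff_single, MonoidAlgebra.coeff_zero, Finsupp.zero_apply] at h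
    rw [Finset.sum_eq_single i] at h
    · simpa using h
    · intro j hj hji
      rw [Finsupp.single_eq_of_ne, smul_zero]
      intro h'
      exact hji (pow_injOn_Iio_orderOf (Finset.mem_range.1 hj) hi h'.symm)
    · intro h'
      exact absurd (Finset.mem_range.2 hi) h'
  · exact coeff_eq_zero_of_natDegree_lt (by omega)

/-- An element fixed by right multiplication by some element of `Δ(G)` lies in every power of
`Δ(G)`. -/
theorem mem_augmentationIdeal_pow_of_mul_eq_self {G : Type*} [Group G] {a t : MonoidAlgebra ℤ G}
    (ha : a ∈ augmentationIdeal G) (h : t * a = t) (k : ℕ) : t ∈ augmentationIdeal G ^ k := by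
  have h1 : t * a ^ k = t := by
    induction k with
    | zero => rw [pow_zero, mul_one]
    | succ k ih => rw [pow_succ, ← mul_assoc, ih, h]
  rw [← h1]
  exact Ideal.mul_mem_left _ _ (Ideal.pow_mem_pow ha k)

/-- If `G` has an element whose order `n > 6` is not a prime power, then the `Δ`-adic residue is
nontrivial. -/
theorem deltaAdicResidue_ne_bot_of_orderOf {G : Type*} [Group G] {g : G} (hn6 : 6 < orderOf g)
    (hn : ∀ {p : ℕ}, p.Prime → ∀ k : ℕ, p ^ k ≠ orderOf g) : deltaAdicResidue G ≠ ⊥ := by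
  intro hbot
  obtain ⟨f, hf⟩ := cyclotomic.dvd_X_pow_sub_one (orderOf g) ℤ
  rw [eq_comm, mul_comm] at hf
  obtain ⟨v, hv⟩ := exists_mul_X_sub_one_add_cyclotomic_eq_one hn
  obtain ⟨w, w', ⟨c, hc⟩, hw⟩ := exists_unit_one_add_mul hn6 hn hf
  let φ : ℤ[X] →ₐ[ℤ] MonoidAlgebra ℤ G := aeval (MonoidAlgebra.of ℤ G g)
  have hφ : φ (X ^ orderOf g - 1) = 0 := by
    rw [map_sub, map_pow, aeval_X, ← map_pow, pow_orderOf_eq_one, map_one, map_one, sub_self]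
  have hmul : φ (1 + w * f) * φ (1 + w' * f) = 1 := by
    have h := congrArg φ hc
    rwa [map_mul φ (X ^ _ - 1), hφ, zero_mul, map_sub, map_one, sub_eq_zero, map_mul] at h
  let u : (MonoidAlgebra ℤ G)ˣ :=
    ⟨φ (1 + w * f), φ (1 + w' * f), hmul, by rw [← map_mul, mul_comm, map_mul, hmul]⟩
  have hu : (u : MonoidAlgebra ℤ G) - 1 = φ w * φ f := by
    change φ (1 + w * f) - 1 = _
    rw [map_add, map_one, add_sub_cancel_left, map_mul]
  have ha : φ (v * (X - 1)) ∈ augmentationIdeal G := by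
    rw [map_mul]
    refine Ideal.mul_mem_left _ _ ?_
    rw [augmentationIdeal, RingHom.mem_ker]
    simp [φ, augmentation]
  -- `v * (X - 1) = 1 - Φ_n`, and `f * Φ_n` maps to `0`.
  have hfa : φ f * φ (v * (X - 1)) = φ f := by
    rw [← map_mul, show f * (v * (X - 1)) = f - (X ^ orderOf g - 1) by
      rw [← hf]; linear_combination f * hv, map_sub, hφ, sub_zero]
  have hmem (k : ℕ) : (u : MonoidAlgebra ℤ G) - 1 ∈ augmentationIdeal G ^ k := by
    rw [hu]
    exact Ideal.mul_mem_left _ _ (mem_augmentationIdeal_pow_of_mul_eq_self ha hfa k)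
  have hnorm : u ∈ normalizedUnits G := by
    have h := hmem 1
    rw [Submodule.pow_one, augmentationIdeal, RingHom.mem_ker, map_sub, map_one, sub_eq_zero] at h
    exact h
  have hres : u ∈ deltaAdicResidue G := by
    simp only [deltaAdicResidue, Subgroup.mem_iInf]
    exact fun k _ => ⟨hnorm, hmem k⟩
  rw [hbot, Subgroup.mem_bot] at hres
  rw [hres, Units.val_one, sub_self, ← map_mul] at hu
  exact hw (X_pow_orderOf_sub_one_dvd_of_aeval_of_eq_zero (orderOf_pos_iff.1 (by omega)) hu.symm)

end IntegralGroupRing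

theorem mainTheorem3 {G : Type*} [Group G]
    (hG : IntegralGroupRing.deltaAdicResidue G = ⊥) :
    (∀ p q : ℕ, p.Prime → q.Prime → p < q → (p, q) ≠ (2, 3) →
      ¬ ∃ g : G, orderOf g = p * q) ∧
    (((∀ g : G, g ^ 2 = 1 → g = 1) ∨ (∀ g : G, g ^ 3 = 1 → g = 1)) →
      ∀ g : G, IsOfFinOrder g → ∃ p k : ℕ, p.Prime ∧ orderOf g = p ^ k) := by
  constructor
  · rintro p q hp hq hpq hne ⟨g, hg⟩
    refine IntegralGroupRing.deltaAdicResidue_ne_bot_of_orderOf (g := g) ?_ ?_ hG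
    · have h2 := hp.two_le
      rw [hg]
      by_cases hp2 : p = 2
      · subst hp2
        have : q ≠ 3 := fun h => hne (by rw [h])
        omega
      · nlinarith [show 3 ≤ p by omega]
    · intro r hr k hk
      rw [hg] at hk
      have h1 : p = r := (Nat.prime_dvd_prime_iff_eq hp hr).1
        (hp.dvd_of_dvd_pow (hk ▸ dvd_mul_right p q))
      have h2 : q = r := (Nat.prime_dvd_prime_iff_eq hq hr).1
        (hq.dvd_of_dvd_pow (hk ▸ dvd_mul_left q p))
      omega
  · intro h23 g hg
    by_contra! hne
    by_cases h6 : 6 < orderOf g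
    · exact IntegralGroupRing.deltaAdicResidue_ne_bot_of_orderOf h6
        (fun {p} hp k hk => hne p k hp hk.symm) hG
    · have hpos := hg.orderOf_pos
      -- The orders 1 (as `2 ^ 0`), 2, 3, 4, 5 are prime powers, leaving 6; then `g ^ 3` has order 2
      -- and `g ^ 2` has order 3, and one of them must be trivial.
      have h1 := hne 2 0 Nat.prime_two
      have h2 := hne 2 1 Nat.prime_two
      have h3 := hne 3 1 Nat.prime_three
      have h4 := hne 2 2 Nat.prime_two
      have h5 := hne 5 1 Nat.prime_five
      have ho : orderOf g = 6 := by omega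
      have hg6 : g ^ 6 = 1 := ho ▸ pow_orderOf_eq_one g
      rcases h23 with h | h
      · have := orderOf_le_of_pow_eq_one (n := 3) (by norm_num)
          (h (g ^ 3) (by rw [← pow_mul]; exact hg6))
        omega
      · have := orderOf_le_of_pow_eq_one (n := 2) (by norm_num)
          (h (g ^ 2) (by rw [← pow_mul]; exact hg6))
        omega
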